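/- Conventions. A planar tree is a finite planar reduced rooted tree (every vertex that is not a leaf has at least two ordered children), up to isomorphism; $\deg T$ is the number of leaves of $T$; $x$ is the tree with one vertex, and $1$ is the empty tree, with $\deg 1=0$. The grafting $T_1\cdots T_m$ of planar trees ($m\ge 2$) is the tree whose root has exactly $T_1,\dots,T_m$ (in this order) as its branches; empty factors are discarded, so that $1$ is a unit. A planar tree power series over a field $K$ is a formal sum $f=\sum_T c_T(f)\,T$ over all planar trees $T$ and $T=1$, with $c_T(f)\in K$; its order is the least degree of a $T$ with $c_T(f)\neq 0$ ($\infty$ if $f=0$). Grafting extends to $m$-ary products of series. For $g$ of order $>0$ put $f(g(x))=\sum_S c_S(f)\,S(g)$, where $1(g)=1$, $x(g)=g$ and $(S_1\cdots S_m)(g)=S_1(g)\cdots S_m(g)$. A planar tree $T$ is right-sided if $T=x\cdot T'$ for some $T'$ (a planar tree or $1$); then $T'$ is unique. A relatively open subtree $U$ of $T$ is a non-empty subtree (connected subgraph) such that every vertex of $U$ having a child in $U$ has all its children in $T$ in $U$; its root $\rho_U$ is its vertex closest to the root of $T$, so that $U$ is itself a planar tree. Let $T=x\cdot T'$ be right-sided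 of degree $>1$. A set $Q$ of relatively open subtrees of $T$ is a right-sided decomposition of $T$ if (i) each $U\in Q$ is right-sided, and if $\deg U>1$, then the first (leftmost) leaf of $U$ is a leaf of $T$; (ii) $\bigcup_{U\in Q}U=T$ (all vertices and all edges); (iii) for every vertex $b$ of $T$, one has $\{b\}\in Q$ if and only if $b$ is a leaf of $T$ that is not the first leaf of any $U\in Q$ with $\deg U>1$; (iv) if $U,U'\in Q$, $U\ne U'$ and $U\cap U'\neq\emptyset$, then $U\cap U'=\{a\}$ for a single vertex $a$, and if $a$ is not the root of $U$, then $a$ is a leaf of $U$ and the root of $U'$. Let $\Gamma(T)$ be the (finite) set of all right-sided decompositions of $T$. Theorem (Lagrange inversion formula for planar tree power series). Let $f$ be a planar tree power series over a field $K$. There is a unique planar tree power series $g$ of order $>0$ over $K$ with $g(x)=x\cdot f(g(x))$. Write $a(T)=c_T(f)$ and $b(T)=c_T(g)$. Then $b(x)=a(1)$, and for every right-sided planar tree $T$ with $\deg T>1$, $$b(T)=\sum_{Q\in\Gamma(T)}\ \prod_{\substack{U\in Q\\ U=x\cdot U'}}a(U').$$ -/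

import Mathlib

/-! # Planar reduced rooted trees -/

/-- Finite planar reduced rooted trees (up to isomorphism): either a single vertex, or a root with
an ordered sequence of at least two subtrees. -/
inductive PRT : Type
  | leaf : PRT
  | node (n : ℕ) (child : Fin (n + 2) → PRT) : PRT

namespace PRT

/-- The degree of a tree: its number of leaves. -/
def deg : PRT → ℕ
  | leaf => 1
  | node _ c => ∑ i, (c i).deg

/-- The degree on trees together with the empty tree `none`, also denoted `1`. -/
def deg' : Option PRT → ℕ
  | none => 0
  | some T => T.deg

/-- Join the members of a forest to a new root; no new root is made for fewer than two members. -/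
def ofForest : List PRT → Option PRT
  | [] => none
  | [T] => some T
  | T₁ :: T₂ :: L => some (node L.length (fun i => (T₁ :: T₂ :: L).get i))

/-- The `m`-ary planar grafting `T₁ ⋯ Tₘ`; empty trees among the factors are discarded, so that
the empty tree is a unit for the product of two trees. -/
def graft {m : ℕ} (p : Fin m → Option PRT) : Option PRT :=
  ofForest (List.ofFn p).reduceOption

/-- `T` is right-sided: `T = x · T'` for some possibly empty tree `T'`, where `x` is the tree with
one vertex. -/
def IsRightSided (T : PRT) : Prop :=
  ∃ T' : Option PRT, graft ![some leaf, T'] = some T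

/-- The factor `T'` of a right-sided tree `T = x · T'` (see `rightFactor_eq`). -/
def rightFactor : PRT → Option PRT
  | leaf => none
  | node _ c => some (c 1)

theorem rightFactor_eq {T : PRT} {T' : Option PRT} (h : graft ![some leaf, T'] = some T) :
    T.rightFactor = T' := by
  cases T' with
  | none =>
    simp [graft, List.reduceOption, ofForest] at h
    subst h
    rfl
  | some S =>
    simp [graft, List.reduceOption, ofForest] at h
    subst h
    rfl

/-! ## Vertices and subtrees

A vertex is named by its address, the list of positions of the edges on the path from the root to
it; the children of `v` have the addresses `v ++ [0]`, `v ++ [1]`, … from left to right. -/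

/-- The vertices of a tree. -/
def verts : PRT → Finset (List ℕ)
  | leaf => {[]}
  | node _ c => insert [] (Finset.univ.biUnion fun i => (c i).verts.image (List.cons i.val))

/-- `v` is a leaf of `T`. -/
def IsLeaf (T : PRT) (v : List ℕ) : Prop :=
  v ∈ T.verts ∧ ∀ i : ℕ, v ++ [i] ∉ T.verts

/-- The closed subtree generated by the vertex `v` of `T` (the value is irrelevant if `v` is not a
vertex of `T`). -/
def closedSubtree : PRT → List ℕ → PRT
  | T, [] => T
  | leaf, _ :: _ => leaf
  | node n c, i :: v => if h : i < n + 2 then (c ⟨i, h⟩).closedSubtree v else leaf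

open Classical in
/-- The planar tree formed by the vertices of an open subtree of `T`, where `P` is the set of its
vertices. -/
noncomputable def prune : PRT → Set (List ℕ) → PRT
  | leaf, _ => leaf
  | node n c, P =>
      if ∀ i : Fin (n + 2), [i.val] ∈ P then
        node n (fun i => (c i).prune {v | i.val :: v ∈ P})
      else leaf

/-- A relatively open subtree `U` of `T`: a nonempty subtree, with `root` its vertex closest to the
root of `T`, such that a vertex of `U` that has some child in `U` has all its children in `U`.
Two vertices of `U` are joined by an edge of `U` exactly if they are joined by an edge of `T`. -/
@[ext] structure RelOpenSubtree (T : PRT) where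
  root : List ℕ
  verts : Finset (List ℕ)
  verts_subset : verts ⊆ T.verts
  root_mem : root ∈ verts
  root_prefix : ∀ v ∈ verts, root <+: v
  parent_mem : ∀ v ∈ verts, v ≠ root → v.dropLast ∈ verts
  children_mem : ∀ (v : List ℕ) (i j : ℕ),
    v ++ [i] ∈ verts → v ∈ verts → v ++ [j] ∈ T.verts → v ++ [j] ∈ verts

noncomputable instance (T : PRT) : Fintype (RelOpenSubtree T) :=
  Fintype.ofInjective
    (fun U : RelOpenSubtree T =>
      ((⟨U.root, U.verts_subset U.root_mem⟩ : {v // v ∈ T.verts}),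
        (⟨U.verts, Finset.mem_powerset.2 U.verts_subset⟩ : {V // V ∈ T.verts.powerset})))
    (by
      intro U W h
      simp only [Prod.mk.injEq, Subtype.mk.injEq] at h
      exact RelOpenSubtree.ext h.1 h.2)

namespace RelOpenSubtree

variable {T : PRT}

/-- `U` as a planar rooted tree. -/
noncomputable def toTree (U : RelOpenSubtree T) : PRT :=
  (T.closedSubtree U.root).prune {v | U.root ++ v ∈ U.verts}

/-- `v` is a leaf of `U`. -/
def IsLeaf (U : RelOpenSubtree T) (v : List ℕ) : Prop :=
  v ∈ U.verts ∧ ∀ i : ℕ, v ++ [i] ∉ U.verts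

/-- `v` is the first (leftmost) leaf of `U`. -/
def IsFirstLeaf (U : RelOpenSubtree T) (v : List ℕ) : Prop :=
  U.IsLeaf v ∧ ∃ k : ℕ, v = U.root ++ List.replicate k 0

end RelOpenSubtree

/-- Right-sided decompositions of a tree `T` into relatively open subtrees. -/
structure IsRightSidedDecomposition (T : PRT) (Q : Finset (RelOpenSubtree T)) : Prop where
  /-- Every piece is right-sided. -/
  rightSided : ∀ U ∈ Q, U.toTree.IsRightSided
  /-- The first leaf of every piece with more than one leaf is a leaf of `T`. -/
  firstLeaf : ∀ U ∈ Q, 1 < U.toTree.deg → ∀ v, U.IsFirstLeaf v → T.IsLeaf v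
  /-- The union of the pieces contains all vertices of `T`. -/
  cover_verts : ∀ v ∈ T.verts, ∃ U ∈ Q, v ∈ U.verts
  /-- The union of the pieces contains all edges of `T`. -/
  cover_edges : ∀ (v : List ℕ) (i : ℕ), v ++ [i] ∈ T.verts →
    ∃ U ∈ Q, v ∈ U.verts ∧ v ++ [i] ∈ U.verts
  /-- The pieces with a single vertex are given by those leaves of `T` that are not the first leaf
  of a piece with more than one leaf. -/
  singletons : ∀ v ∈ T.verts,
    (∃ U ∈ Q, U.verts = {v}) ↔
      T.IsLeaf v ∧ ∀ W ∈ Q, 1 < W.toTree.deg → ¬ W.IsFirstLeaf v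
  /-- Two different pieces that meet have exactly one vertex in common, and if this is not the root
  of one of them, then it is a leaf of this one and the root of the other. -/
  inter : ∀ U ∈ Q, ∀ W ∈ Q, U ≠ W → (U.verts ∩ W.verts).Nonempty →
    ∃ v, U.verts ∩ W.verts = {v} ∧ (v ≠ U.root → U.IsLeaf v ∧ v = W.root)

open Classical in
/-- The finite set of all right-sided decompositions of `T`. -/
noncomputable def rightSidedDecompositions (T : PRT) : Finset (Finset (RelOpenSubtree T)) :=
  Finset.univ.filter T.IsRightSidedDecomposition

end PRT

/-! # Planar tree power series -/

/-- Planar tree power series `∑ c_T T` over `K`, given by the coefficients `c_T`, where `T` runs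
through all finite planar reduced rooted trees and the empty tree `none`. -/
def PlanarTreeSeries (K : Type*) : Type _ := Option PRT → K

namespace PlanarTreeSeries

variable {K : Type*} [Field K]

/-- The coefficient of a series at a possibly empty tree. -/
def coeff (f : PlanarTreeSeries K) (T : Option PRT) : K := f T

/-- The order of a series: the least degree of a tree with nonzero coefficient (`⊤` for the
series `0`). -/
noncomputable def ord (f : PlanarTreeSeries K) : ℕ∞ :=
  ⨅ (T : Option PRT) (_ : f.coeff T ≠ 0), (PRT.deg' T : ℕ∞)

open Classical in
/-- The series with the single term `T`. -/
noncomputable def single (T : Option PRT) : PlanarTreeSeries K :=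
  fun S => if S = T then 1 else 0

/-- The series `x`. -/
noncomputable def X : PlanarTreeSeries K := single (some PRT.leaf)

/-- The `m`-ary product of series that planar grafting induces. Each coefficient is a sum over the
finitely many ways to obtain `T` by grafting `m` trees. -/
noncomputable def graft {m : ℕ} (h : Fin m → PlanarTreeSeries K) : PlanarTreeSeries K :=
  fun T => ∑ᶠ (p : Fin m → Option PRT) (_ : PRT.graft p = T), ∏ i, (h i).coeff (p i)

/-- The product of two series. -/
noncomputable def mul (f g : PlanarTreeSeries K) : PlanarTreeSeries K := graft ![f, g]

/-- `T(g)`: the series obtained by putting `g` in place of every leaf of `T`. -/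
noncomputable def evalTree (g : PlanarTreeSeries K) : PRT → PlanarTreeSeries K
  | .leaf => g
  | .node _ c => graft fun i => evalTree g (c i)

/-- `T(g)` for a possibly empty tree `T`. -/
noncomputable def evalTree' (g : PlanarTreeSeries K) : Option PRT → PlanarTreeSeries K
  | none => single none
  | some T => evalTree g T

/-- `f(g(x)) = ∑ c_S(f) S(g)`, for a series `g` of positive order. Each coefficient is then a
finite sum, because `S(g)` has order at least `deg S`. -/
noncomputable def subst (f g : PlanarTreeSeries K) : PlanarTreeSeries K :=
  fun T => ∑ᶠ S : Option PRT, f.coeff S * (evalTree' g S).coeff T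

end PlanarTreeSeries

/-! # Lagrange inversion for planar tree power series

Write `a` and `b` for the coefficients of `f` and of `g`, and `1` for the empty tree.
Comparing coefficients, `g = x · f(g)` with `g` of positive order says that `b(x) = a(1)`, that
`b(T) = 0` if `T` is not right-sided, and that `b(x · T')` is the coefficient of `T'` in
`f(g) = ∑ a(S) S(g)`. As `g` has no term in degree `0`, a tree `T'` occurs in `S(g)` only if `S` is
obtained from `T'` by cutting it at some vertices (`IsPruning`), and then with the coefficient
`∏ b(T'_v)`, where `v` runs through the leaves of `S` and `T'_v` is the part of `T'` above `v`
(`coeff_evalTree`). The prunings `S` of `T'` correspond to the open subtrees `U₀ = x · S` of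
`T = x · T'` with the same root as `T`, which are the possible root pieces of a right-sided
decomposition of `T`; the leaves of `S` are the leaves of `U₀` other than the first one, the joints
of `U₀`. So the equation is equivalent to the recursion
`b(x · T') = ∑ a(S) ∏ b(T_v)`, the sum being over root pieces `U₀ = x · S` and the product over the
joints `v` of `U₀` (`eq_X_mul_subst_iff`). It determines `g`, since every `T_v` is smaller
than `T`.

The sum over right-sided decompositions satisfies the same recursion. A decomposition `Q` has
exactly one root piece `U₀`; every other piece lies above exactly one joint of `U₀`, and the
pieces above a joint `v` form a right-sided decomposition of `T_v`. Conversely any choice of a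
decomposition of each `T_v` can be put on top of `U₀` (`restrict_isRightSidedDecomposition`,
`isRightSidedDecomposition_of_restrict`, `sum_decompositions_of_rootPiece`). For the tree with one
vertex there is a single decomposition, of weight `a(1)`, and a tree that is not right-sided has
none, so the sum has the right values at these trees as well.
-/

namespace PRT

/-! ### Vertices -/

theorem nil_mem_verts (T : PRT) : [] ∈ T.verts := by
  cases T <;> simp [verts]

theorem cons_notMem_verts_leaf (i : ℕ) (v : List ℕ) : i :: v ∉ leaf.verts := by
  simp [verts]

theorem cons_mem_verts_node {n : ℕ} {c : Fin (n + 2) → PRT} {i : ℕ} {v : List ℕ} :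
    i :: v ∈ (node n c).verts ↔ ∃ h : i < n + 2, v ∈ (c ⟨i, h⟩).verts := by
  simp only [verts, Finset.mem_insert, reduceCtorEq, Finset.mem_biUnion, Finset.mem_univ,
    Finset.mem_image, List.cons.injEq, true_and, false_or]
  constructor
  · rintro ⟨j, u, hu, rfl, rfl⟩
    exact ⟨j.2, hu⟩
  · rintro ⟨h, hv⟩
    exact ⟨⟨i, h⟩, v, hv, rfl, rfl⟩

theorem singleton_mem_verts_node {n : ℕ} {c : Fin (n + 2) → PRT} {i : ℕ} :
    [i] ∈ (node n c).verts ↔ i < n + 2 := by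
  simp [cons_mem_verts_node, nil_mem_verts]

@[simp] theorem closedSubtree_nil (T : PRT) : T.closedSubtree [] = T := by
  cases T <;> rfl

theorem closedSubtree_append (T : PRT) (v u : List ℕ) :
    T.closedSubtree (v ++ u) = (T.closedSubtree v).closedSubtree u := by
  induction v generalizing T with
  | nil => simp
  | cons i v ih =>
    have hleaf : ∀ u, leaf.closedSubtree u = leaf := by
      rintro (_ | _) <;> rfl
    cases T with
    | leaf => simp [hleaf]
    | node n c =>
      by_cases h : i < n + 2
      · simp [closedSubtree, h, ih]
      · simp [closedSubtree, h, hleaf]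

theorem append_mem_verts {T : PRT} {v u : List ℕ} :
    v ++ u ∈ T.verts ↔ v ∈ T.verts ∧ u ∈ (T.closedSubtree v).verts := by
  induction v generalizing T with
  | nil => simp [nil_mem_verts]
  | cons i v ih =>
    cases T with
    | leaf => simp [cons_notMem_verts_leaf]
    | node n c =>
      rw [List.cons_append, cons_mem_verts_node, cons_mem_verts_node]
      by_cases h : i < n + 2 <;> simp [closedSubtree, h, ih]

theorem mem_verts_of_prefix {T : PRT} {v u : List ℕ} (h : v <+: u) (hu : u ∈ T.verts) :
    v ∈ T.verts := by
  obtain ⟨s, rfl⟩ := h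
  exact (append_mem_verts.1 hu).1

/-- A vertex with some child has a first and a second child. -/
theorem append_singleton_mem_verts {T : PRT} {v : List ℕ} {i j : ℕ} (h : v ++ [i] ∈ T.verts)
    (hj : j < 2) : v ++ [j] ∈ T.verts := by
  rw [append_mem_verts] at h ⊢
  refine ⟨h.1, ?_⟩
  have h2 := h.2
  generalize T.closedSubtree v = S at h2
  cases S with
  | leaf => exact absurd h2 (cons_notMem_verts_leaf _ _)
  | node n c => exact singleton_mem_verts_node.2 (by omega)

theorem isLeaf_append {T : PRT} {v u : List ℕ} (hv : v ∈ T.verts) :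
    T.IsLeaf (v ++ u) ↔ (T.closedSubtree v).IsLeaf u := by
  simp only [IsLeaf, List.append_assoc, append_mem_verts (v := v), hv, true_and]

theorem deg_pos (T : PRT) : 0 < T.deg := by
  induction T with
  | leaf => simp [deg]
  | node n c ih => exact Finset.sum_pos (fun i _ => ih i) Finset.univ_nonempty

theorem one_lt_deg_node {n : ℕ} (c : Fin (n + 2) → PRT) : 1 < (node n c).deg := by
  have h : ∑ _i : Fin (n + 2), 1 ≤ ∑ i, (c i).deg := Finset.sum_le_sum fun i _ => deg_pos (c i)
  simp only [Finset.sum_const, Finset.card_univ, Fintype.card_fin, smul_eq_mul, mul_one] at h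
  simp only [deg]
  omega

theorem one_lt_deg_iff {T : PRT} : 1 < T.deg ↔ [0] ∈ T.verts := by
  cases T with
  | leaf => simp [deg, cons_notMem_verts_leaf]
  | node n c => simp [one_lt_deg_node, singleton_mem_verts_node]

/-- The tree `x · S`. -/
abbrev leafMul (S : PRT) : PRT := node 0 ![leaf, S]

theorem graft_leaf_none : graft ![some leaf, none] = some leaf := by
  simp [graft, List.reduceOption, ofForest]

theorem node_congr {n m : ℕ} {c : Fin (n + 2) → PRT} {d : Fin (m + 2) → PRT} (h : n = m)
    (hcd : ∀ i, c i = d (Fin.cast (by rw [h]) i)) : node n c = node m d := by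
  subst h
  congr 1
  funext i
  exact hcd i

theorem graft_some {n : ℕ} (c : Fin (n + 2) → PRT) :
    graft (fun i => some (c i)) = some (node n c) := by
  have h1 : (List.ofFn fun i => some (c i)).reduceOption = List.ofFn c := by
    have : (List.ofFn fun i => some (c i)) = (List.ofFn c).map some := by
      rw [List.map_ofFn]; rfl
    rw [this]
    simp [List.reduceOption]
  rw [graft, h1, List.ofFn_succ, List.ofFn_succ, ofForest]
  congr 1
  refine node_congr (by simp) fun i => ?_
  refine Fin.cases ?_ (fun i => Fin.cases ?_ (fun i => ?_) i) i
  · rfl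
  · rfl
  · simp
    rfl

theorem graft_leaf_some (S : PRT) : graft ![some leaf, some S] = some (leafMul S) := by
  rw [leafMul, ← graft_some]
  congr 1
  funext i
  fin_cases i <;> rfl

theorem isRightSided_iff {T : PRT} : T.IsRightSided ↔ T = leaf ∨ ∃ S, T = leafMul S := by
  constructor
  · rintro ⟨_ | S, h⟩
    · rw [graft_leaf_none, Option.some_inj] at h
      exact Or.inl h.symm
    · rw [graft_leaf_some, Option.some_inj] at h
      exact Or.inr ⟨S, h.symm⟩
  · rintro (rfl | ⟨S, rfl⟩)
    · exact ⟨none, graft_leaf_none⟩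
    · exact ⟨some S, graft_leaf_some S⟩

/-! ### Relatively open subtrees -/

/-- For the vertex set `P` of an open subtree, pruning keeps exactly the vertices in `P`. -/
theorem mem_verts_prune {T : PRT} {P : Set (List ℕ)} (h0 : [] ∈ P)
    (h1 : ∀ v i, v ++ [i] ∈ P → v ∈ P)
    (h2 : ∀ v i j, v ++ [i] ∈ P → v ++ [j] ∈ T.verts → v ++ [j] ∈ P) {u : List ℕ} :
    u ∈ (T.prune P).verts ↔ u ∈ T.verts ∧ u ∈ P := by
  have hpre : ∀ v s, v ++ s ∈ P → v ∈ P := by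
    intro v s
    induction s using List.reverseRecOn with
    | nil => simp
    | append_singleton s i ih =>
      intro h
      rw [← List.append_assoc] at h
      exact ih (h1 _ _ h)
  induction T generalizing P u with
  | leaf =>
    simp only [prune, verts, Finset.mem_singleton]
    exact ⟨fun h => ⟨h, h ▸ h0⟩, fun h => h.1⟩
  | node n c ih =>
    cases u with
    | nil => simp [nil_mem_verts, h0]
    | cons i u =>
      by_cases hc : ∀ i : Fin (n + 2), [i.val] ∈ P
      · simp only [prune, if_pos hc, cons_mem_verts_node]
        have key : ∀ h : i < n + 2, u ∈ ((c ⟨i, h⟩).prune {v | i :: v ∈ P}).verts ↔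
            u ∈ (c ⟨i, h⟩).verts ∧ u ∈ {v | i :: v ∈ P} := fun h =>
          ih ⟨i, h⟩ (P := {v | i :: v ∈ P}) (hc ⟨i, h⟩) (fun v j hv => h1 (i :: v) j hv)
            (fun v j k hv hk => h2 (i :: v) j k hv (cons_mem_verts_node.2 ⟨h, hk⟩))
            (fun v s hv => hpre (i :: v) s hv)
        constructor
        · rintro ⟨h, hu⟩
          exact ⟨⟨h, ((key h).1 hu).1⟩, ((key h).1 hu).2⟩
        · rintro ⟨⟨h, hu⟩, hP⟩
          exact ⟨h, (key h).2 ⟨hu, hP⟩⟩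
      · simp only [prune, if_neg hc, cons_notMem_verts_leaf, false_iff, not_and]
        intro hu hP
        exact hc fun j => h2 [] i j (hpre [i] u hP) (singleton_mem_verts_node.2 j.2)

namespace RelOpenSubtree

variable {T : PRT}

theorem root_mem_verts (U : RelOpenSubtree T) : U.root ∈ T.verts := U.verts_subset U.root_mem

theorem mem_of_prefix (U : RelOpenSubtree T) {p v : List ℕ} (hp : U.root <+: p) (hpv : p <+: v)
    (hv : v ∈ U.verts) : p ∈ U.verts := by
  obtain ⟨s, rfl⟩ := hpv
  induction s using List.reverseRecOn with
  | nil => simpa using hv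
  | append_singleton s i ih =>
    rw [← List.append_assoc] at hv
    refine ih ?_
    have := U.parent_mem _ hv (fun h => ?_)
    · simpa using this
    · have h1 := hp.length_le
      have h2 := congrArg List.length h
      simp at h2
      omega

theorem mem_verts_toTree (U : RelOpenSubtree T) {u : List ℕ} :
    u ∈ U.toTree.verts ↔ U.root ++ u ∈ U.verts := by
  rw [toTree, mem_verts_prune]
  · refine ⟨fun h => h.2, fun h => ⟨?_, h⟩⟩
    exact (append_mem_verts.1 (U.verts_subset h)).2
  · simpa using U.root_mem
  · intro v i h
    exact U.mem_of_prefix (List.prefix_append _ _) (v := U.root ++ (v ++ [i]))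
      ⟨[i], by simp⟩ h
  · intro v i j h hj
    have h' : (U.root ++ v) ++ [i] ∈ U.verts := by simpa using h
    have hv : U.root ++ v ∈ U.verts :=
      U.mem_of_prefix (List.prefix_append _ _) ⟨[i], rfl⟩ h'
    have := U.children_mem _ i j h' hv (by
      rw [List.append_assoc, append_mem_verts]
      exact ⟨U.root_mem_verts, hj⟩)
    simpa using this

theorem one_lt_deg_toTree (U : RelOpenSubtree T) :
    1 < U.toTree.deg ↔ U.root ++ [0] ∈ U.verts := by
  rw [one_lt_deg_iff, mem_verts_toTree]

theorem append_zero_mem (U : RelOpenSubtree T) {v : List ℕ} {i : ℕ} (hv : v ∈ U.verts)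
    (h : v ++ [i] ∈ U.verts) : v ++ [0] ∈ U.verts :=
  U.children_mem v i 0 h hv (append_singleton_mem_verts (U.verts_subset h) two_pos)

theorem verts_eq_singleton (U : RelOpenSubtree T) (h : ¬ 1 < U.toTree.deg) :
    U.verts = {U.root} := by
  refine Finset.eq_singleton_iff_unique_mem.2 ⟨U.root_mem, fun u hu => ?_⟩
  obtain ⟨s, rfl⟩ := U.root_prefix u hu
  cases s with
  | nil => simp
  | cons i s =>
    refine absurd (U.one_lt_deg_toTree.2 ?_) h
    refine U.append_zero_mem (i := i) U.root_mem ?_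
    exact U.mem_of_prefix (List.prefix_append _ _) ⟨s, by simp⟩ hu

theorem IsLeaf.eq_of_prefix {U : RelOpenSubtree T} {v u : List ℕ} (hv : U.IsLeaf v)
    (hu : u ∈ U.verts) (h : v <+: u) : u = v := by
  obtain ⟨s, rfl⟩ := h
  cases s with
  | nil => simp
  | cons i s =>
    refine absurd ?_ (hv.2 i)
    exact U.mem_of_prefix ((U.root_prefix v hv.1).trans (List.prefix_append _ _))
      ⟨s, by simp⟩ hu

/-- Two leaves below a common vertex agree. -/
theorem IsLeaf.eq_of_prefix_prefix {U : RelOpenSubtree T} {v w u : List ℕ} (hv : U.IsLeaf v)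
    (hw : U.IsLeaf w) (hvu : v <+: u) (hwu : w <+: u) : v = w := by
  rcases List.prefix_or_prefix_of_prefix hvu hwu with h | h
  · exact (hv.eq_of_prefix hw.1 h).symm
  · exact hw.eq_of_prefix hv.1 h

/-- A vertex of `T` above the root of `U` but outside of `U` lies above a leaf of `U`. -/
theorem exists_isLeaf_prefix (U : RelOpenSubtree T) {u : List ℕ} (hr : U.root <+: u)
    (hu : u ∈ T.verts) (hU : u ∉ U.verts) : ∃ v, U.IsLeaf v ∧ v <+: u ∧ v ≠ u := by
  induction u using List.reverseRecOn with
  | nil =>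
    rw [List.prefix_nil] at hr
    exact absurd (hr ▸ U.root_mem) hU
  | append_singleton p i ih =>
    have hrp : U.root <+: p := by
      rcases List.prefix_concat_iff.1 hr with h | h
      · exact absurd (h ▸ U.root_mem) hU
      · exact h
    by_cases hp : p ∈ U.verts
    · exact ⟨p, ⟨hp, fun j hj => hU (U.children_mem p j i hj hp hu)⟩, List.prefix_append _ _,
        by simp⟩
    · obtain ⟨v, hv, hvp, _⟩ := ih hrp (append_mem_verts.1 hu).1 hp
      refine ⟨v, hv, hvp.trans (List.prefix_append _ _), ?_⟩
      rintro rfl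
      exact hU hv.1

theorem IsFirstLeaf.ne_root {U : RelOpenSubtree T} {v : List ℕ} (hv : U.IsFirstLeaf v)
    (h : 1 < U.toTree.deg) : v ≠ U.root := by
  rintro rfl
  exact hv.1.2 0 (U.one_lt_deg_toTree.1 h)

/-- The pieces of a right-sided decomposition have different roots: pieces of degree `> 1` with the
same root would share the children of the root as well. -/
theorem eq_of_root_eq {Q : Finset (RelOpenSubtree T)} (hQ : T.IsRightSidedDecomposition Q)
    {U W : RelOpenSubtree T} (hU : U ∈ Q) (hW : W ∈ Q) (h : U.root = W.root) : U = W := by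
  by_contra hne
  -- a singleton at a vertex with a child in another piece would not be a leaf of `T`
  have aux : ∀ U ∈ Q, ∀ W ∈ Q, U.root = W.root → 1 < U.toTree.deg → 1 < W.toTree.deg := by
    intro U hU W hW h hd
    by_contra hWd
    have h1 := ((hQ.singletons W.root W.root_mem_verts).1
      ⟨W, hW, W.verts_eq_singleton hWd⟩).1
    exact h1.2 0 (h ▸ U.verts_subset (U.one_lt_deg_toTree.1 hd))
  by_cases hd : 1 < U.toTree.deg
  · have hWd := aux U hU W hW h hd
    obtain ⟨v, hv, -⟩ := hQ.inter U hU W hW hne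
      ⟨U.root, Finset.mem_inter.2 ⟨U.root_mem, h ▸ W.root_mem⟩⟩
    have h1 : U.root ∈ U.verts ∩ W.verts :=
      Finset.mem_inter.2 ⟨U.root_mem, h ▸ W.root_mem⟩
    have h2 : U.root ++ [0] ∈ U.verts ∩ W.verts :=
      Finset.mem_inter.2 ⟨U.one_lt_deg_toTree.1 hd, h ▸ W.one_lt_deg_toTree.1 hWd⟩
    rw [hv, Finset.mem_singleton] at h1 h2
    simpa using h2.trans h1.symm
  · have hWd : ¬ 1 < W.toTree.deg := fun hWd => hd (aux W hW U hU h.symm hWd)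
    exact hne (RelOpenSubtree.ext h (by
      rw [U.verts_eq_singleton hd, W.verts_eq_singleton hWd, h]))

/-! ### Subtrees of a closed subtree -/

/-- A relatively open subtree of the closed subtree at `v`, as a subtree of the whole tree. -/
def lift {v : List ℕ} (hv : v ∈ T.verts) (U : RelOpenSubtree (T.closedSubtree v)) :
    RelOpenSubtree T where
  root := v ++ U.root
  verts := U.verts.map ⟨(v ++ ·), List.append_right_injective v⟩
  verts_subset := by
    intro u hu
    obtain ⟨u, hu', rfl⟩ := Finset.mem_map.1 hu
    exact append_mem_verts.2 ⟨hv, U.verts_subset hu'⟩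
  root_mem := Finset.mem_map_of_mem _ U.root_mem
  root_prefix := by
    intro u hu
    obtain ⟨u, hu', rfl⟩ := Finset.mem_map.1 hu
    exact (List.prefix_append_right_inj v).2 (U.root_prefix u hu')
  parent_mem := by
    intro u hu hne
    obtain ⟨u, hu', rfl⟩ := Finset.mem_map.1 hu
    simp only [Function.Embedding.coeFn_mk, ne_eq, List.append_cancel_left_eq] at hne ⊢
    have hu0 : u ≠ [] := by
      rintro rfl
      exact hne (List.prefix_nil.1 (U.root_prefix _ hu')).symm
    rw [List.dropLast_append_of_ne_nil hu0]
    exact Finset.mem_map_of_mem _ (U.parent_mem u hu' hne)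
  children_mem := by
    intro u i j hi hu hj
    obtain ⟨u, hu', rfl⟩ := Finset.mem_map.1 hu
    simp only [Function.Embedding.coeFn_mk, List.append_assoc, Finset.mem_map,
      List.append_cancel_left_eq, exists_eq_right] at hi hj ⊢
    exact U.children_mem u i j hi hu' (append_mem_verts.1 hj).2

variable {v : List ℕ} (hv : v ∈ T.verts)

@[simp] theorem lift_root (U : RelOpenSubtree (T.closedSubtree v)) :
    (U.lift hv).root = v ++ U.root := rfl

@[simp] theorem append_mem_lift {U : RelOpenSubtree (T.closedSubtree v)} {u : List ℕ} :
    v ++ u ∈ (U.lift hv).verts ↔ u ∈ U.verts := by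
  simp [lift]

theorem mem_lift {U : RelOpenSubtree (T.closedSubtree v)} {u : List ℕ} :
    u ∈ (U.lift hv).verts ↔ ∃ s ∈ U.verts, v ++ s = u := by
  simp [lift]

theorem lift_injective : Function.Injective (lift hv) := by
  intro U W h
  refine RelOpenSubtree.ext ?_ ?_
  · exact List.append_cancel_left (congrArg root h)
  · ext u
    rw [← append_mem_lift hv, h, append_mem_lift]

@[simp] theorem toTree_lift (U : RelOpenSubtree (T.closedSubtree v)) :
    (U.lift hv).toTree = U.toTree := by
  simp only [toTree, lift_root, closedSubtree_append, List.append_assoc, append_mem_lift]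

@[simp] theorem isLeaf_lift {U : RelOpenSubtree (T.closedSubtree v)} {u : List ℕ} :
    (U.lift hv).IsLeaf (v ++ u) ↔ U.IsLeaf u := by
  simp [RelOpenSubtree.IsLeaf]

@[simp] theorem isFirstLeaf_lift {U : RelOpenSubtree (T.closedSubtree v)} {u : List ℕ} :
    (U.lift hv).IsFirstLeaf (v ++ u) ↔ U.IsFirstLeaf u := by
  simp [IsFirstLeaf]

/-- Every relatively open subtree with root above `v` comes from the closed subtree at `v`. -/
theorem exists_lift_eq (W : RelOpenSubtree T) (h : v <+: W.root) :
    ∃ U : RelOpenSubtree (T.closedSubtree v), U.lift hv = W := by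
  obtain ⟨r, hr⟩ := h
  have hinj : Function.Injective (v ++ ·) := List.append_right_injective v
  refine ⟨⟨r, W.verts.preimage (v ++ ·) hinj.injOn, ?_, ?_, ?_, ?_, ?_⟩, ?_⟩
  · intro u hu
    exact (append_mem_verts.1 (W.verts_subset (Finset.mem_preimage.1 hu))).2
  · simpa [hr] using W.root_mem
  · intro u hu
    have := W.root_prefix _ (Finset.mem_preimage.1 hu)
    rwa [← hr, List.prefix_append_right_inj] at this
  · intro u hu hne
    have hu0 : u ≠ [] := by
      rintro rfl
      have := W.root_prefix _ (Finset.mem_preimage.1 hu)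
      rw [← hr, List.prefix_append_right_inj, List.prefix_nil] at this
      exact hne this.symm
    have := W.parent_mem _ (Finset.mem_preimage.1 hu) (by rw [← hr]; simpa using hne)
    rw [List.dropLast_append_of_ne_nil hu0] at this
    simpa using this
  · intro u i j hi hu hj
    simp only [Finset.mem_preimage, ← List.append_assoc] at hi hu ⊢
    exact W.children_mem _ i j hi hu (by
      rw [List.append_assoc]
      exact append_mem_verts.2 ⟨hv, hj⟩)
  · refine RelOpenSubtree.ext hr ?_
    ext u
    simp only [mem_lift, Finset.mem_preimage]
    constructor
    · rintro ⟨s, hs, rfl⟩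
      exact hs
    · intro hu
      have h1 : v <+: u := List.IsPrefix.trans ⟨r, hr⟩ (W.root_prefix u hu)
      obtain ⟨s, rfl⟩ := h1
      exact ⟨s, hu, rfl⟩

theorem prefix_of_mem_lift {U : RelOpenSubtree (T.closedSubtree v)} {u : List ℕ}
    (h : u ∈ (U.lift hv).verts) : v <+: u := by
  obtain ⟨s, -, rfl⟩ := (mem_lift hv).1 h
  exact List.prefix_append _ _

end RelOpenSubtree

end PRT

namespace PRT

/-! ### Splitting a decomposition at its root piece -/

open Classical in
/-- The members of `Q` that lie in the closed subtree at `v`. -/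
noncomputable def restrict {T : PRT} (Q : Finset (RelOpenSubtree T)) {v : List ℕ}
    (hv : v ∈ T.verts) : Finset (RelOpenSubtree (T.closedSubtree v)) :=
  Finset.univ.filter fun U => U.lift hv ∈ Q

@[simp] theorem mem_restrict {T : PRT} {Q : Finset (RelOpenSubtree T)} {v : List ℕ}
    {hv : v ∈ T.verts} {U : RelOpenSubtree (T.closedSubtree v)} :
    U ∈ restrict Q hv ↔ U.lift hv ∈ Q := by
  simp [restrict]

namespace RelOpenSubtree

variable {T : PRT}

/-- `U` is a possible root piece of a right-sided decomposition of `T` into more than one piece: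
it has the same root as `T`, it is right-sided of degree `> 1`, and its first leaf is a leaf
of `T`. -/
structure IsRootPiece (U : RelOpenSubtree T) : Prop where
  root_eq : U.root = []
  zero_mem : [0] ∈ U.verts
  isLeaf_zero : T.IsLeaf [0]
  rightSided : U.toTree.IsRightSided

/-- The vertices at which the other pieces are attached to a root piece: its leaves, except for
the first one. -/
def IsJoint (U : RelOpenSubtree T) (v : List ℕ) : Prop := U.IsLeaf v ∧ v ≠ [0]

theorem IsJoint.mem_verts {U : RelOpenSubtree T} {v : List ℕ} (h : U.IsJoint v) : v ∈ T.verts :=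
  U.verts_subset h.1.1

theorem IsJoint.eq_of_prefix_prefix {U : RelOpenSubtree T} {v w u : List ℕ} (hv : U.IsJoint v)
    (hw : U.IsJoint w) (hvu : v <+: u) (hwu : w <+: u) : v = w :=
  hv.1.eq_of_prefix_prefix hw.1 hvu hwu

namespace IsRootPiece

variable {U₀ : RelOpenSubtree T} (h : U₀.IsRootPiece)

include h

theorem one_lt_deg : 1 < U₀.toTree.deg := by
  rw [one_lt_deg_toTree, h.root_eq]
  exact h.zero_mem

theorem root_isPrefix (u : List ℕ) : U₀.root <+: u := by
  rw [h.root_eq]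
  exact List.nil_prefix

theorem joint_ne_nil {v : List ℕ} (hv : U₀.IsJoint v) : v ≠ [] := by
  rintro rfl
  exact hv.1.2 0 h.zero_mem

theorem isLeaf_firstLeaf : U₀.IsLeaf [0] :=
  ⟨h.zero_mem, fun i hi => h.isLeaf_zero.2 i (U₀.verts_subset hi)⟩

theorem isFirstLeaf_iff {u : List ℕ} : U₀.IsFirstLeaf u ↔ u = [0] := by
  constructor
  · rintro ⟨hu, k, hk⟩
    rw [h.root_eq, List.nil_append] at hk
    cases k with
    | zero =>
      rw [hk] at hu
      exact absurd h.zero_mem (hu.2 0)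
    | succ k =>
      refine h.isLeaf_firstLeaf.eq_of_prefix hu.1 ?_
      rw [hk, List.replicate_succ]
      exact ⟨_, rfl⟩
  · rintro rfl
    exact ⟨h.isLeaf_firstLeaf, 1, by simp [h.root_eq]⟩

theorem not_joint_prefix_zero {v : List ℕ} (hv : U₀.IsJoint v) : ¬ v <+: [0] := fun hp =>
  hv.2 (hv.1.eq_of_prefix h.isLeaf_firstLeaf.1 hp).symm

/-- Every vertex outside of the root piece lies above a joint. -/
theorem exists_joint {u : List ℕ} (hu : u ∈ T.verts) (hU : u ∉ U₀.verts) :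
    ∃ v, U₀.IsJoint v ∧ v <+: u ∧ v ≠ u := by
  obtain ⟨v, hv, hvu, hne⟩ := U₀.exists_isLeaf_prefix (h.root_isPrefix u) hu hU
  refine ⟨v, ⟨hv, ?_⟩, hvu, hne⟩
  rintro rfl
  obtain ⟨s, rfl⟩ := hvu
  cases s with
  | nil => simp at hne
  | cons i s =>
    exact h.isLeaf_zero.2 i (mem_verts_of_prefix (u := [0] ++ i :: s) ⟨s, by simp⟩ hu)

variable {Q : Finset (RelOpenSubtree T)} (hU₀ : U₀ ∈ Q)

include hU₀

/-- In a right-sided decomposition, every piece except for the root piece lies above a joint of the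
root piece. -/
theorem exists_joint_prefix_root (hQ : T.IsRightSidedDecomposition Q) {W : RelOpenSubtree T}
    (hW : W ∈ Q) (hne : W ≠ U₀) : ∃ v, U₀.IsJoint v ∧ v <+: W.root := by
  by_cases hm : W.root ∈ U₀.verts
  · obtain ⟨v, hv, hv'⟩ := hQ.inter U₀ hU₀ W hW hne.symm
      ⟨W.root, Finset.mem_inter.2 ⟨hm, W.root_mem⟩⟩
    have h1 : W.root = v := by
      have : W.root ∈ U₀.verts ∩ W.verts := Finset.mem_inter.2 ⟨hm, W.root_mem⟩
      rwa [hv, Finset.mem_singleton] at this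
    have h2 : v ≠ U₀.root := fun hvr =>
      hne (eq_of_root_eq hQ hW hU₀ (h1.trans hvr))
    refine ⟨v, ⟨(hv' h2).1, ?_⟩, h1 ▸ List.prefix_rfl⟩
    rintro rfl
    -- `W` would be the single vertex `[0]`, which is the first leaf of `U₀`
    have hd : ¬ 1 < W.toTree.deg := by
      rw [one_lt_deg_toTree, h1]
      exact fun hh => h.isLeaf_zero.2 0 (W.verts_subset hh)
    have h3 := (hQ.singletons [0] h.isLeaf_zero.1).1
      ⟨W, hW, by rw [W.verts_eq_singleton hd, h1]⟩
    exact h3.2 U₀ hU₀ h.one_lt_deg (h.isFirstLeaf_iff.2 rfl)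
  · obtain ⟨v, hv, hvW, -⟩ := h.exists_joint W.root_mem_verts hm
    exact ⟨v, hv, hvW⟩

variable (hjoint : ∀ W ∈ Q, W ≠ U₀ → ∃ v, U₀.IsJoint v ∧ v <+: W.root)

include hjoint

omit h hU₀ in
theorem exists_lift_mem_of_ne {W : RelOpenSubtree T} (hW : W ∈ Q) (hne : W ≠ U₀) :
    ∃ (v : List ℕ) (hv : U₀.IsJoint v), ∃ U ∈ restrict Q hv.mem_verts,
      U.lift hv.mem_verts = W := by
  obtain ⟨v, hv, hvW⟩ := hjoint W hW hne
  obtain ⟨U, rfl⟩ := W.exists_lift_eq hv.mem_verts hvW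
  exact ⟨v, hv, U, mem_restrict.2 hW, rfl⟩

omit h hU₀ in
/-- A piece containing a vertex above the joint `v` is the root piece or lies above `v`. -/
theorem exists_lift_eq_of_mem {v u : List ℕ} (hv : U₀.IsJoint v) {W : RelOpenSubtree T}
    (hW : W ∈ Q) (hne : W ≠ U₀) (hvu : v <+: u) (hu : u ∈ W.verts) :
    ∃ U ∈ restrict Q hv.mem_verts, U.lift hv.mem_verts = W := by
  obtain ⟨w, hw, U, hU, rfl⟩ := exists_lift_mem_of_ne hjoint hW hne
  obtain rfl := hw.eq_of_prefix_prefix hv (prefix_of_mem_lift _ hu) hvu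
  exact ⟨U, hU, rfl⟩

/-- Condition (iii) for vertices above a joint. -/
theorem singletons_iff {v u : List ℕ} (hv : U₀.IsJoint v) :
    ((∃ U ∈ Q, U.verts = {v ++ u}) ↔
      T.IsLeaf (v ++ u) ∧ ∀ W ∈ Q, 1 < W.toTree.deg → ¬ W.IsFirstLeaf (v ++ u)) ↔
    ((∃ U ∈ restrict Q hv.mem_verts, U.verts = {u}) ↔
      (T.closedSubtree v).IsLeaf u ∧
        ∀ W ∈ restrict Q hv.mem_verts, 1 < W.toTree.deg → ¬ W.IsFirstLeaf u) := by
  have hmem := hv.mem_verts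
  refine iff_congr ?_ (and_congr (isLeaf_append hmem) ?_)
  · constructor
    · rintro ⟨W, hW, hWu⟩
      have hne : W ≠ U₀ := by
        rintro rfl
        have h1 := h.zero_mem
        have h2 := W.root_mem
        rw [h.root_eq] at h2
        rw [hWu, Finset.mem_singleton] at h1 h2
        simp [← h2] at h1
      obtain ⟨U, hU, rfl⟩ := exists_lift_eq_of_mem hjoint hv hW hne
        (List.prefix_append v u) (by simp [hWu])
      refine ⟨U, hU, ?_⟩
      ext s
      rw [← append_mem_lift hmem, hWu]
      simp
    · rintro ⟨U, hU, hUu⟩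
      exact ⟨_, mem_restrict.1 hU, by simp [lift, hUu]⟩
  · constructor
    · intro hW U hU hd hf
      exact hW _ (mem_restrict.1 hU) (by simpa using hd) (by simpa using hf)
    · intro hW W hWQ hd hf
      by_cases hne : W = U₀
      · subst hne
        refine h.not_joint_prefix_zero hv ?_
        rw [← h.isFirstLeaf_iff.1 hf]
        exact List.prefix_append _ _
      · obtain ⟨U, hU, rfl⟩ := exists_lift_eq_of_mem hjoint hv hWQ hne
          (List.prefix_append v u) hf.1.1
        exact hW U hU (by simpa using hd) (by simpa using hf)

/-- The pieces above a joint `v` of the root piece decompose the closed subtree at `v`. -/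
theorem restrict_isRightSidedDecomposition (hQ : T.IsRightSidedDecomposition Q) {v : List ℕ}
    (hv : U₀.IsJoint v) :
    (T.closedSubtree v).IsRightSidedDecomposition (restrict Q hv.mem_verts) := by
  have hmem := hv.mem_verts
  have hvnil := h.joint_ne_nil hv
  have hedge : ∀ u i, u ++ [i] ∈ (T.closedSubtree v).verts →
      ∃ U ∈ restrict Q hmem, u ∈ U.verts ∧ u ++ [i] ∈ U.verts := by
    intro u i hu
    obtain ⟨W, hW, h1, h2⟩ := hQ.cover_edges (v ++ u) i (by
      rw [List.append_assoc]
      exact append_mem_verts.2 ⟨hmem, hu⟩)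
    have hne : W ≠ U₀ := by
      rintro rfl
      have := hv.1.eq_of_prefix h2 ⟨u ++ [i], by simp⟩
      simp at this
    obtain ⟨U, hU, rfl⟩ := exists_lift_eq_of_mem hjoint hv hW hne
      (List.prefix_append v u) h1
    refine ⟨U, hU, (append_mem_lift hmem).1 h1, ?_⟩
    rw [List.append_assoc] at h2
    exact (append_mem_lift hmem).1 h2
  refine ⟨?_, ?_, ?_, hedge, ?_, ?_⟩
  · intro U hU
    simpa using hQ.rightSided _ (mem_restrict.1 hU)
  · intro U hU hd u hu
    rw [← isLeaf_append hmem]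
    exact hQ.firstLeaf _ (mem_restrict.1 hU) (by simpa using hd) _ (by simpa using hu)
  · intro u hu
    by_cases hu0 : u = []
    · subst hu0
      by_cases hleaf : T.IsLeaf v
      · have hs : ∃ U ∈ Q, U.verts = {v} := by
          refine (hQ.singletons v hmem).2 ⟨hleaf, fun W hW hd hf => ?_⟩
          by_cases hne : W = U₀
          · subst hne
            exact hv.2 (h.isFirstLeaf_iff.1 hf)
          · obtain ⟨U, hU, rfl⟩ := exists_lift_eq_of_mem hjoint hv hW hne
              List.prefix_rfl hf.1.1
            refine hf.ne_root hd ?_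
            have := (U.lift hmem).root_prefix _ hf.1.1
            exact (List.IsPrefix.eq_of_length_le this (by simp)).symm
        obtain ⟨W, hW, hWv⟩ := hs
        have hvW : v ∈ W.verts := by simp [hWv]
        have hne : W ≠ U₀ := by
          rintro rfl
          have h2 := W.root_mem
          rw [h.root_eq, hWv, Finset.mem_singleton] at h2
          exact hvnil h2.symm
        obtain ⟨U, hU, rfl⟩ := exists_lift_eq_of_mem hjoint hv hW hne
          List.prefix_rfl hvW
        exact ⟨U, hU, by rw [← append_mem_lift hmem]; simpa using hvW⟩
      · simp only [PRT.IsLeaf, hmem, true_and, not_forall, not_not] at hleaf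
        obtain ⟨i, hi⟩ := hleaf
        obtain ⟨U, hU, h1, -⟩ := hedge [] i (append_mem_verts.1 hi).2
        exact ⟨U, hU, h1⟩
    · obtain ⟨p, i, rfl⟩ := List.eq_nil_or_concat u |>.resolve_left hu0
      rw [List.concat_eq_append] at hu ⊢
      obtain ⟨U, hU, -, h2⟩ := hedge p i hu
      exact ⟨U, hU, h2⟩
  · intro u hu
    exact (h.singletons_iff hU₀ hjoint hv).1
      (hQ.singletons _ (append_mem_verts.2 ⟨hmem, hu⟩))
  · intro U hU W hW hne hne'
    obtain ⟨u, hu⟩ := hne'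
    have hvu : v ++ u ∈ (U.lift hmem).verts ∩ (W.lift hmem).verts := by simpa using hu
    obtain ⟨w, hw, hw'⟩ := hQ.inter _ (mem_restrict.1 hU) _ (mem_restrict.1 hW)
      (fun hh => hne (lift_injective hmem hh)) ⟨_, hvu⟩
    rw [hw, Finset.mem_singleton] at hvu
    subst hvu
    refine ⟨u, ?_, ?_⟩
    · ext s
      have := Finset.ext_iff.1 hw (v ++ s)
      simpa using this
    · simpa using hw'

/-- Decompositions of the closed subtrees at the joints of a root piece combine to a decomposition
of the whole tree. -/
theorem isRightSidedDecomposition_of_restrict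
    (hres : ∀ v (hv : U₀.IsJoint v),
      (T.closedSubtree v).IsRightSidedDecomposition (restrict Q hv.mem_verts)) :
    T.IsRightSidedDecomposition Q := by
  have hmeet : ∀ v (hv : U₀.IsJoint v) (U : RelOpenSubtree (T.closedSubtree v)) (u : List ℕ),
      u ∈ U₀.verts → u ∈ (U.lift hv.mem_verts).verts →
        u = v ∧ (U.lift hv.mem_verts).root = v := by
    intro v hv U u hu hu'
    have h1 : u = v := hv.1.eq_of_prefix hu (prefix_of_mem_lift _ hu')
    refine ⟨h1, ?_⟩
    have h2 := (U.lift hv.mem_verts).root_prefix u hu'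
    rw [h1] at h2
    exact List.IsPrefix.eq_of_length_le h2 (by simp)
  refine ⟨?_, ?_, ?_, ?_, ?_, ?_⟩
  · intro W hW
    by_cases hne : W = U₀
    · exact hne ▸ h.rightSided
    · obtain ⟨v, hv, U, hU, rfl⟩ := exists_lift_mem_of_ne hjoint hW hne
      simpa using (hres v hv).rightSided U hU
  · intro W hW hd u hu
    by_cases hne : W = U₀
    · subst hne
      rw [h.isFirstLeaf_iff.1 hu]
      exact h.isLeaf_zero
    · obtain ⟨v, hv, U, hU, rfl⟩ := exists_lift_mem_of_ne hjoint hW hne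
      obtain ⟨s, rfl⟩ := prefix_of_mem_lift _ hu.1.1
      rw [isLeaf_append hv.mem_verts]
      exact (hres v hv).firstLeaf U hU (by simpa using hd) s (by simpa using hu)
  · intro u hu
    by_cases hm : u ∈ U₀.verts
    · exact ⟨U₀, hU₀, hm⟩
    · obtain ⟨v, hv, ⟨s, rfl⟩, -⟩ := h.exists_joint hu hm
      obtain ⟨U, hU, hs⟩ := (hres v hv).cover_verts s (append_mem_verts.1 hu).2
      exact ⟨_, mem_restrict.1 hU, (append_mem_lift _).2 hs⟩
  · intro u i hu
    by_cases hm : u ++ [i] ∈ U₀.verts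
    · exact ⟨U₀, hU₀, U₀.mem_of_prefix (h.root_isPrefix u) (List.prefix_append _ _) hm, hm⟩
    · obtain ⟨v, hv, hvu, hne⟩ := h.exists_joint hu hm
      obtain ⟨s, rfl⟩ := (List.prefix_concat_iff.1 hvu).resolve_left hne
      rw [List.append_assoc] at hu
      obtain ⟨U, hU, h1, h2⟩ := (hres v hv).cover_edges s i (append_mem_verts.1 hu).2
      refine ⟨_, mem_restrict.1 hU, (append_mem_lift _).2 h1, ?_⟩
      rw [List.append_assoc]
      exact (append_mem_lift _).2 h2
  · intro u hu
    by_cases hj : ∃ v, U₀.IsJoint v ∧ v <+: u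
    · obtain ⟨v, hv, s, rfl⟩ := hj
      exact (h.singletons_iff hU₀ hjoint hv).2
        ((hres v hv).singletons s (append_mem_verts.1 hu).2)
    · -- `u` is the first leaf or an inner vertex of `U₀`, so both sides fail
      have hm : u ∈ U₀.verts := by
        by_contra hm
        obtain ⟨v, hv, hvu, -⟩ := h.exists_joint hu hm
        exact hj ⟨v, hv, hvu⟩
      refine iff_of_false ?_ ?_
      · rintro ⟨W, hW, hWu⟩
        by_cases hne : W = U₀
        · subst hne
          have h1 := h.zero_mem
          have h2 := W.root_mem
          rw [h.root_eq] at h2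
          rw [hWu, Finset.mem_singleton] at h1 h2
          simp [← h2] at h1
        · obtain ⟨v, hv, hvW⟩ := hjoint W hW hne
          exact hj ⟨v, hv, hvW.trans (W.root_prefix u (by simp [hWu]))⟩
      · rintro ⟨hl, hf⟩
        refine hj ⟨u, ⟨⟨hm, fun i hi => hl.2 i (U₀.verts_subset hi)⟩, ?_⟩, List.prefix_rfl⟩
        rintro rfl
        exact hf U₀ hU₀ h.one_lt_deg (h.isFirstLeaf_iff.2 rfl)
  · intro W hW W' hW' hne hn
    obtain ⟨u, hn⟩ := hn
    obtain ⟨hu, hu'⟩ := Finset.mem_inter.1 hn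
    by_cases h1 : W = U₀
    · subst h1
      obtain ⟨v, hv, U, hU, rfl⟩ := exists_lift_mem_of_ne hjoint hW' (Ne.symm hne)
      obtain ⟨rfl, hr⟩ := hmeet v hv U u hu hu'
      refine ⟨u, Finset.eq_singleton_iff_unique_mem.2
        ⟨Finset.mem_inter.2 ⟨hu, hu'⟩, fun s hs => ?_⟩, fun _ => ⟨hv.1, hr.symm⟩⟩
      exact (hmeet u hv U s (Finset.mem_inter.1 hs).1 (Finset.mem_inter.1 hs).2).1
    · obtain ⟨v, hv, U, hU, rfl⟩ := exists_lift_mem_of_ne hjoint hW h1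
      by_cases h2 : W' = U₀
      · subst h2
        obtain ⟨rfl, hr⟩ := hmeet v hv U u hu' hu
        refine ⟨u, Finset.eq_singleton_iff_unique_mem.2
          ⟨Finset.mem_inter.2 ⟨hu, hu'⟩, fun s hs => ?_⟩, fun hh => absurd hr.symm hh⟩
        exact (hmeet u hv U s (Finset.mem_inter.1 hs).2 (Finset.mem_inter.1 hs).1).1
      · obtain ⟨U', hU', rfl⟩ := exists_lift_eq_of_mem hjoint hv hW' h2
          (prefix_of_mem_lift _ hu) hu'
        obtain ⟨s, rfl⟩ := prefix_of_mem_lift _ hu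
        obtain ⟨w, hw, hw'⟩ := (hres v hv).inter U hU U' hU' (fun hh => hne (by rw [hh]))
          ⟨s, by simpa using And.intro hu hu'⟩
        refine ⟨v ++ w, ?_, by simpa using hw'⟩
        ext t
        constructor
        · intro ht
          obtain ⟨ht, ht'⟩ := Finset.mem_inter.1 ht
          obtain ⟨r, rfl⟩ := prefix_of_mem_lift _ ht
          have := Finset.ext_iff.1 hw r
          simpa using this.1 (by simpa using And.intro ht ht')
        · intro ht
          rw [Finset.mem_singleton] at ht
          subst ht
          have := Finset.ext_iff.1 hw w
          simpa using this

end IsRootPiece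

end RelOpenSubtree

end PRT

namespace PRT

/-! ### The recursion for the sum over all decompositions -/

namespace RelOpenSubtree

open Classical in
/-- The finite set of the joints of `U`. -/
noncomputable def joints {T : PRT} (U : RelOpenSubtree T) : Finset (List ℕ) :=
  U.verts.filter U.IsJoint

@[simp] theorem mem_joints {T : PRT} {U : RelOpenSubtree T} {v : List ℕ} :
    v ∈ U.joints ↔ U.IsJoint v := by
  simp only [joints, Finset.mem_filter, and_iff_right_iff_imp]
  exact fun h => h.1.1

end RelOpenSubtree

open Classical in
/-- The finite set of all possible root pieces of right-sided decompositions of `T` into more than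
one piece. -/
noncomputable def rootPieces (T : PRT) : Finset (RelOpenSubtree T) :=
  Finset.univ.filter fun U => U.IsRootPiece

@[simp] theorem mem_rootPieces {T : PRT} {U : RelOpenSubtree T} :
    U ∈ T.rootPieces ↔ U.IsRootPiece := by
  simp [rootPieces]

@[simp] theorem mem_rightSidedDecompositions {T : PRT} {Q : Finset (RelOpenSubtree T)} :
    Q ∈ T.rightSidedDecompositions ↔ T.IsRightSidedDecomposition Q := by
  simp [rightSidedDecompositions]

/-- The piece covering the leftmost edge at the root is a root piece. -/
theorem IsRightSidedDecomposition.exists_isRootPiece {T : PRT} (hT : [0] ∈ T.verts)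
    {Q : Finset (RelOpenSubtree T)} (hQ : T.IsRightSidedDecomposition Q) :
    ∃ U ∈ Q, U.IsRootPiece := by
  obtain ⟨U, hU, h1, h2⟩ := hQ.cover_edges [] 0 hT
  have hr : U.root = [] := List.prefix_nil.1 (U.root_prefix [] h1)
  have hd : 1 < U.toTree.deg := by rwa [U.one_lt_deg_toTree, hr]
  refine ⟨U, hU, hr, h2, ?_, hQ.rightSided U hU⟩
  refine hQ.firstLeaf U hU hd [0] ⟨⟨h2, fun i hi => ?_⟩, 1, by simp [hr]⟩
  have h3 : [0] ++ [i] ∈ U.toTree.verts := by rwa [U.mem_verts_toTree, hr]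
  obtain h4 | ⟨S, h4⟩ := isRightSided_iff.1 (hQ.rightSided U hU)
  · simp [h4, verts] at h3
  · rw [h4, leafMul, List.singleton_append, cons_mem_verts_node] at h3
    obtain ⟨_, h3⟩ := h3
    exact cons_notMem_verts_leaf _ _ h3

theorem IsRightSidedDecomposition.eq_of_isRootPiece {T : PRT}
    {Q : Finset (RelOpenSubtree T)} (hQ : T.IsRightSidedDecomposition Q)
    {U : RelOpenSubtree T} (hU : U ∈ Q) (h : U.IsRootPiece) :
    ∀ W ∈ Q, W.IsRootPiece → W = U := fun _ hW h' =>
  RelOpenSubtree.eq_of_root_eq hQ hW hU (h'.root_eq.trans h.root_eq.symm)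

variable {K : Type*} [Field K]

/-- The sum over all right-sided decompositions of `T` on the right-hand side of the inversion
formula. -/
noncomputable def decompositionSum (f : PlanarTreeSeries K) (T : PRT) : K :=
  ∑ Q ∈ T.rightSidedDecompositions, ∏ U ∈ Q, f.coeff U.toTree.rightFactor

open Classical in
/-- The decompositions with a given root piece `U₀` are obtained by choosing, independently for
each joint `v` of `U₀`, a decomposition of the closed subtree at `v`. -/
theorem sum_decompositions_of_rootPiece (f : PlanarTreeSeries K) {T : PRT}
    {U₀ : RelOpenSubtree T} (h : U₀.IsRootPiece) :
    ∑ Q ∈ T.rightSidedDecompositions with U₀ ∈ Q, ∏ U ∈ Q, f.coeff U.toTree.rightFactor =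
      f.coeff U₀.toTree.rightFactor *
        ∏ v ∈ U₀.joints, decompositionSum f (T.closedSubtree v) := by
  have hj : ∀ v : U₀.joints, U₀.IsJoint v := fun v => RelOpenSubtree.mem_joints.1 v.2
  -- the inverse map: put the chosen decompositions on top of `U₀`
  let glue : (∀ v : U₀.joints, Finset (RelOpenSubtree (T.closedSubtree v))) →
      Finset (RelOpenSubtree T) := fun p =>
    Finset.univ.biUnion fun v : U₀.joints =>
      (p v).map ⟨_, RelOpenSubtree.lift_injective (hj v).mem_verts⟩
  have mem_glue : ∀ p W, W ∈ glue p ↔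
      ∃ v : U₀.joints, ∃ U ∈ p v, U.lift (hj v).mem_verts = W := by
    intro p W
    simp only [glue, Finset.mem_biUnion, Finset.mem_univ, true_and, Finset.mem_map,
      Function.Embedding.coeFn_mk]
  have root_ne : ∀ (v : U₀.joints) (U : RelOpenSubtree (T.closedSubtree v)),
      U.lift (hj v).mem_verts ≠ U₀ := by
    intro v U hU
    have h1 := congrArg RelOpenSubtree.root hU
    rw [h.root_eq, RelOpenSubtree.lift_root, List.append_eq_nil_iff] at h1
    exact h.joint_ne_nil (hj v) h1.1
  have lift_disj : ∀ (v w : U₀.joints) (U : RelOpenSubtree (T.closedSubtree v))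
      (W : RelOpenSubtree (T.closedSubtree w)),
      U.lift (hj v).mem_verts = W.lift (hj w).mem_verts → v = w := by
    intro v w U W hUW
    refine Subtype.ext ((hj v).eq_of_prefix_prefix (hj w) (List.prefix_append _ U.root) ?_)
    have h1 := congrArg RelOpenSubtree.root hUW
    rw [RelOpenSubtree.lift_root, RelOpenSubtree.lift_root] at h1
    exact ⟨_, h1.symm⟩
  have restrict_glue : ∀ p (v : U₀.joints),
      restrict (insert U₀ (glue p)) (hj v).mem_verts = p v := by
    intro p v
    ext U
    rw [mem_restrict, Finset.mem_insert, mem_glue]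
    constructor
    · rintro (hU | ⟨w, W, hW, hWU⟩)
      · exact absurd hU (root_ne v U)
      · obtain rfl := lift_disj _ _ _ _ hWU
        rwa [← RelOpenSubtree.lift_injective _ hWU]
    · exact fun hU => Or.inr ⟨v, U, hU, rfl⟩
  have glue_restrict : ∀ Q, T.IsRightSidedDecomposition Q → U₀ ∈ Q →
      insert U₀ (glue fun v => restrict Q (hj v).mem_verts) = Q := by
    intro Q hQ hU₀
    ext W
    rw [Finset.mem_insert, mem_glue]
    constructor
    · rintro (rfl | ⟨v, U, hU, rfl⟩)
      · exact hU₀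
      · exact mem_restrict.1 hU
    · intro hW
      refine or_iff_not_imp_left.2 fun hne => ?_
      obtain ⟨v, hv, U, hU, hUW⟩ := RelOpenSubtree.IsRootPiece.exists_lift_mem_of_ne
        (fun W hW hne => h.exists_joint_prefix_root hU₀ hQ hW hne) hW hne
      exact ⟨⟨v, RelOpenSubtree.mem_joints.2 hv⟩, U, hU, hUW⟩
  have notMem_glue : ∀ p, U₀ ∉ glue p := by
    intro p hp
    obtain ⟨v, U, -, hU⟩ := (mem_glue p U₀).1 hp
    exact root_ne v U hU
  have hsum : ∏ v ∈ U₀.joints, decompositionSum f (T.closedSubtree v) =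
      ∑ p ∈ Fintype.piFinset fun v : U₀.joints => (T.closedSubtree v).rightSidedDecompositions,
        ∏ v, ∏ U ∈ p v, f.coeff U.toTree.rightFactor := by
    rw [← Finset.prod_coe_sort]
    exact Finset.prod_univ_sum _ _
  rw [hsum, Finset.mul_sum]
  refine Finset.sum_nbij' (fun Q v => restrict Q (hj v).mem_verts)
    (fun p => insert U₀ (glue p)) ?_ ?_ ?_ ?_ ?_
  · intro Q hQ
    obtain ⟨hQ, hU₀⟩ := Finset.mem_filter.1 hQ
    rw [mem_rightSidedDecompositions] at hQ
    refine Fintype.mem_piFinset.2 fun v => mem_rightSidedDecompositions.2 ?_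
    exact h.restrict_isRightSidedDecomposition hU₀
      (fun W hW hne => h.exists_joint_prefix_root hU₀ hQ hW hne) hQ (hj v)
  · intro p hp
    rw [Fintype.mem_piFinset] at hp
    refine Finset.mem_filter.2 ⟨mem_rightSidedDecompositions.2 ?_, Finset.mem_insert_self _ _⟩
    refine h.isRightSidedDecomposition_of_restrict (Finset.mem_insert_self _ _) ?_ ?_
    · intro W hW hne
      obtain ⟨v, U, -, rfl⟩ := (mem_glue p W).1 ((Finset.mem_insert.1 hW).resolve_left hne)
      exact ⟨v, hj v, List.prefix_append _ _⟩
    · intro v hv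
      have h1 := hp ⟨v, RelOpenSubtree.mem_joints.2 hv⟩
      rw [← restrict_glue p] at h1
      exact mem_rightSidedDecompositions.1 h1
  · intro Q hQ
    obtain ⟨hQ, hU₀⟩ := Finset.mem_filter.1 hQ
    rw [mem_rightSidedDecompositions] at hQ
    exact glue_restrict Q hQ hU₀
  · intro p _
    funext v
    exact restrict_glue p v
  · intro Q hQ
    obtain ⟨hQ, hU₀⟩ := Finset.mem_filter.1 hQ
    rw [mem_rightSidedDecompositions] at hQ
    nth_rewrite 1 [← glue_restrict Q hQ hU₀]
    rw [Finset.prod_insert (notMem_glue _), Finset.prod_biUnion]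
    · simp
    · intro v _ w _ hvw
      refine Finset.disjoint_left.2 fun W hW hW' => hvw ?_
      obtain ⟨U, -, rfl⟩ := Finset.mem_map.1 hW
      obtain ⟨U', -, hU'⟩ := Finset.mem_map.1 hW'
      exact lift_disj v w U U' hU'.symm

open Classical in
/-- Sorting the decompositions by their root pieces yields a recursion for their weighted sum. -/
theorem decompositionSum_eq (f : PlanarTreeSeries K) {T : PRT} (hT : [0] ∈ T.verts) :
    decompositionSum f T = ∑ U ∈ T.rootPieces, f.coeff U.toTree.rightFactor *
      ∏ v ∈ U.joints, decompositionSum f (T.closedSubtree v) := by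
  rw [← Finset.sum_congr rfl fun U hU =>
    sum_decompositions_of_rootPiece f (mem_rootPieces.1 hU), decompositionSum]
  rw [← Finset.sum_comm' (s := T.rightSidedDecompositions)
    (t := fun Q => Q.filter fun U => U.IsRootPiece) (by simp; tauto)]
  refine Finset.sum_congr rfl fun Q hQ => ?_
  rw [mem_rightSidedDecompositions] at hQ
  obtain ⟨U, hU, h⟩ := hQ.exists_isRootPiece hT
  have : (Q.filter fun U => U.IsRootPiece) = {U} :=
    Finset.eq_singleton_iff_unique_mem.2 ⟨by simp [hU, h], fun W hW =>
      hQ.eq_of_isRootPiece hU h W (Finset.mem_filter.1 hW).1 (Finset.mem_filter.1 hW).2⟩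
  rw [this, Finset.sum_singleton]

/-- A tree of degree `> 1` with a root piece is right-sided, hence other trees have no
right-sided decomposition. -/
theorem decompositionSum_eq_zero (f : PlanarTreeSeries K) {T : PRT} (hT : ¬ T.IsRightSided) :
    decompositionSum f T = 0 := by
  refine Finset.sum_eq_zero fun Q hQ => absurd ?_ hT
  rw [mem_rightSidedDecompositions] at hQ
  cases T with
  | leaf => exact isRightSided_iff.2 (Or.inl rfl)
  | node n c =>
    obtain ⟨U, hU, h⟩ := hQ.exists_isRootPiece (singleton_mem_verts_node.2 (by omega))
    obtain h1 | ⟨S, h1⟩ := isRightSided_iff.1 h.rightSided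
    · have := h.one_lt_deg
      simp [h1, deg] at this
    · rw [RelOpenSubtree.toTree, h.root_eq, closedSubtree_nil, prune, leafMul] at h1
      split_ifs at h1
      obtain ⟨rfl, -⟩ := node.inj h1
      refine isRightSided_iff.2 (Or.inr ⟨c 1, ?_⟩)
      have h2 : c 0 = leaf := by
        cases h3 : c 0 with
        | leaf => rfl
        | node m d =>
          refine absurd ?_ (h.isLeaf_zero.2 0)
          refine cons_mem_verts_node.2 ⟨by omega, ?_⟩
          change [0] ∈ (c 0).verts
          rw [h3]
          exact singleton_mem_verts_node.2 (by omega)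
      rw [leafMul]
      congr 1
      funext i
      fin_cases i
      · exact h2
      · rfl

theorem decompositionSum_leaf (f : PlanarTreeSeries K) :
    decompositionSum f leaf = f.coeff none := by
  let U₀ : RelOpenSubtree leaf :=
    { root := []
      verts := {[]}
      verts_subset := by simp [verts]
      root_mem := by simp
      root_prefix := by simp
      parent_mem := by simp
      children_mem := by simp }
  have hU : ∀ U : RelOpenSubtree leaf, U = U₀ := by
    intro U
    have h1 : ∀ u ∈ U.verts, u = [] := fun u hu => by
      simpa [verts] using U.verts_subset hu
    have h2 : U.root = [] := h1 _ U.root_mem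
    refine RelOpenSubtree.ext h2 (Finset.eq_singleton_iff_unique_mem.2 ⟨?_, h1⟩)
    exact h2 ▸ U.root_mem
  have ht : U₀.toTree = leaf := rfl
  have hQ : leaf.rightSidedDecompositions = {{U₀}} := by
    refine Finset.eq_singleton_iff_unique_mem.2 ⟨?_, fun Q hQ => ?_⟩
    · rw [mem_rightSidedDecompositions]
      refine ⟨?_, ?_, ?_, ?_, ?_, ?_⟩
      · simp [ht, isRightSided_iff]
      · simp [ht, deg]
      · simp [U₀, verts]
      · simp [verts]
      · simp [ht, deg, U₀, verts, IsLeaf]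
      · simp
    · rw [mem_rightSidedDecompositions] at hQ
      obtain ⟨U, hUQ, -⟩ := hQ.cover_verts [] (nil_mem_verts _)
      exact Finset.eq_singleton_iff_unique_mem.2 ⟨hU U ▸ hUQ, fun W _ => hU W⟩
  simp [decompositionSum, hQ, ht, rightFactor]

end PRT

namespace PRT

/-! ### Prunings -/

/-- `IsPruning S T`: the tree `S` arises from `T` by cutting `T` at some of its vertices, so that
`S` is an open subtree of `T` with the same root. -/
inductive IsPruning : PRT → PRT → Prop
  | leaf (T : PRT) : IsPruning leaf T
  | node {n : ℕ} {c d : Fin (n + 2) → PRT} (h : ∀ i, IsPruning (c i) (d i)) :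
      IsPruning (node n c) (node n d)

theorem isPruning_node_iff {n : ℕ} {c : Fin (n + 2) → PRT} {T : PRT} :
    IsPruning (node n c) T ↔ ∃ d, T = node n d ∧ ∀ i, IsPruning (c i) (d i) := by
  constructor
  · intro h
    cases h with
    | node h => exact ⟨_, rfl, h⟩
  · rintro ⟨d, rfl, h⟩
    exact .node h

theorem isPruning_leafMul {S T : PRT} : IsPruning (leafMul S) (leafMul T) ↔ IsPruning S T := by
  constructor
  · intro h
    cases h with
    | node h => exact h 1
  · intro h
    refine .node fun i => ?_
    fin_cases i
    · exact .leaf _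
    · exact h

theorem isPruning_prune (T : PRT) (P : Set (List ℕ)) : IsPruning (T.prune P) T := by
  induction T generalizing P with
  | leaf => exact .leaf _
  | node n c ih =>
    rw [prune]
    split_ifs
    · exact .node fun i => ih i _
    · exact .leaf _

theorem IsPruning.verts_subset {S T : PRT} (h : IsPruning S T) : S.verts ⊆ T.verts := by
  induction h with
  | leaf T => simp [verts, nil_mem_verts]
  | node h ih =>
    rintro (_ | ⟨i, u⟩) hu
    · exact nil_mem_verts _
    · obtain ⟨hi, hu⟩ := cons_mem_verts_node.1 hu
      exact cons_mem_verts_node.2 ⟨hi, ih _ hu⟩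

theorem IsPruning.children_mem {S T : PRT} (h : IsPruning S T) {v : List ℕ} {i j : ℕ}
    (hi : v ++ [i] ∈ S.verts) (hj : v ++ [j] ∈ T.verts) : v ++ [j] ∈ S.verts := by
  induction h generalizing v with
  | leaf T => simp [verts] at hi
  | node h ih =>
    cases v with
    | nil =>
      rw [List.nil_append, singleton_mem_verts_node] at hj ⊢
      exact hj
    | cons k v =>
      obtain ⟨hk, hi⟩ := cons_mem_verts_node.1 hi
      obtain ⟨_, hj⟩ := cons_mem_verts_node.1 hj
      exact cons_mem_verts_node.2 ⟨hk, ih _ hi hj⟩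

/-- A pruning is determined by its vertices. -/
theorem IsPruning.eq_of_verts_eq {S S' T : PRT} (h : IsPruning S T) (h' : IsPruning S' T)
    (hv : S.verts = S'.verts) : S = S' := by
  have aux : ∀ {n : ℕ} {c : Fin (n + 2) → PRT}, PRT.leaf.verts ≠ (PRT.node n c).verts := by
    intro n c hh
    have h1 : [0] ∈ (PRT.node n c).verts := singleton_mem_verts_node.2 (by omega)
    rw [← hh] at h1
    exact cons_notMem_verts_leaf _ _ h1
  induction h generalizing S' with
  | leaf T =>
    cases h' with
    | leaf => rfl
    | node => exact absurd hv aux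
  | @node n c d h ih =>
    cases h' with
    | leaf => exact absurd hv.symm aux
    | @node _ c' _ h' =>
      congr 1
      funext i
      refine ih i (h' i) ?_
      ext u
      have := Finset.ext_iff.1 hv (i.val :: u)
      simpa [cons_mem_verts_node] using this

/-- The open subtree with the same root that is given by a pruning. -/
def IsPruning.toRelOpenSubtree {S T : PRT} (h : IsPruning S T) : RelOpenSubtree T where
  root := []
  verts := S.verts
  verts_subset := h.verts_subset
  root_mem := nil_mem_verts S
  root_prefix _ _ := List.nil_prefix
  parent_mem v hv _ := mem_verts_of_prefix (List.dropLast_prefix v) hv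
  children_mem _ _ _ hi _ hj := h.children_mem hi hj

namespace RelOpenSubtree

variable {T : PRT} {U : RelOpenSubtree T}

theorem verts_toTree (h : U.root = []) : U.toTree.verts = U.verts := by
  ext u
  rw [mem_verts_toTree, h, List.nil_append]

theorem isPruning_toTree (h : U.root = []) : IsPruning U.toTree T := by
  rw [toTree, h, closedSubtree_nil]
  exact isPruning_prune _ _

theorem eq_of_toTree_eq {W : RelOpenSubtree T} (hU : U.root = []) (hW : W.root = [])
    (h : U.toTree = W.toTree) : U = W :=
  RelOpenSubtree.ext (hU.trans hW.symm) (by rw [← verts_toTree hU, h, verts_toTree hW])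

theorem isLeaf_toTree (h : U.root = []) {v : List ℕ} : U.toTree.IsLeaf v ↔ U.IsLeaf v := by
  rw [PRT.IsLeaf, RelOpenSubtree.IsLeaf, verts_toTree h]

theorem IsRootPiece.exists_toTree_eq (h : U.IsRootPiece) : ∃ S, U.toTree = leafMul S := by
  refine (isRightSided_iff.1 h.rightSided).resolve_left fun h1 => ?_
  have := h.one_lt_deg
  simp [h1, deg] at this

end RelOpenSubtree

theorem IsPruning.toTree_toRelOpenSubtree {S T : PRT} (h : IsPruning S T) :
    h.toRelOpenSubtree.toTree = S :=
  (RelOpenSubtree.isPruning_toTree rfl).eq_of_verts_eq h (RelOpenSubtree.verts_toTree rfl)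

theorem IsPruning.isRootPiece {S T : PRT} (h : IsPruning (leafMul S) (leafMul T)) :
    h.toRelOpenSubtree.IsRootPiece := by
  refine ⟨rfl, singleton_mem_verts_node.2 two_pos,
    ⟨singleton_mem_verts_node.2 two_pos, fun i hi => ?_⟩, ?_⟩
  · obtain ⟨_, hi⟩ := cons_mem_verts_node.1 hi
    exact cons_notMem_verts_leaf _ _ hi
  · rw [h.toTree_toRelOpenSubtree]
    exact isRightSided_iff.2 (Or.inr ⟨S, rfl⟩)

/-- The finite set of the leaves of a tree. -/
def leaves : PRT → Finset (List ℕ)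
  | leaf => {[]}
  | node _ c => Finset.univ.biUnion fun i => (c i).leaves.image (List.cons i.val)

theorem isLeaf_node_cons {n : ℕ} {c : Fin (n + 2) → PRT} {i : ℕ} {v : List ℕ} :
    (node n c).IsLeaf (i :: v) ↔ ∃ h : i < n + 2, (c ⟨i, h⟩).IsLeaf v := by
  simp only [IsLeaf, List.cons_append, cons_mem_verts_node]
  constructor
  · rintro ⟨⟨h, hv⟩, h2⟩
    exact ⟨h, hv, fun j hj => h2 j ⟨h, hj⟩⟩
  · rintro ⟨h, hv, h2⟩
    exact ⟨⟨h, hv⟩, fun j ⟨_, hj⟩ => h2 j hj⟩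

theorem mem_leaves {T : PRT} {v : List ℕ} : v ∈ T.leaves ↔ T.IsLeaf v := by
  induction T generalizing v with
  | leaf => simp +contextual [leaves, IsLeaf, verts]
  | node n c ih =>
    cases v with
    | nil =>
      have h1 : [0] ∈ (node n c).verts := singleton_mem_verts_node.2 (by omega)
      simp only [leaves, Finset.mem_biUnion, Finset.mem_univ, Finset.mem_image, reduceCtorEq,
        and_false, exists_false, false_iff]
      exact fun h => h.2 0 h1
    | cons i v =>
      rw [isLeaf_node_cons]
      simp only [leaves, Finset.mem_biUnion, Finset.mem_univ, Finset.mem_image, true_and,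
        List.cons.injEq]
      constructor
      · rintro ⟨j, u, hu, rfl, rfl⟩
        exact ⟨j.2, (ih j).1 hu⟩
      · rintro ⟨h, hv⟩
        exact ⟨⟨i, h⟩, v, (ih _).2 hv, rfl, rfl⟩

theorem prod_leaves_node {M : Type*} [CommMonoid M] {n : ℕ} (c : Fin (n + 2) → PRT)
    (F : List ℕ → M) :
    ∏ v ∈ (node n c).leaves, F v = ∏ i, ∏ v ∈ (c i).leaves, F (i.val :: v) := by
  rw [leaves, Finset.prod_biUnion]
  · refine Finset.prod_congr rfl fun i _ => ?_
    rw [Finset.prod_image]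
    intro u _ v _ h
    exact List.cons_injective h
  · intro i _ j _ hij
    refine Finset.disjoint_left.2 fun v hv hv' => hij ?_
    obtain ⟨u, -, rfl⟩ := Finset.mem_image.1 hv
    obtain ⟨w, -, hw⟩ := Finset.mem_image.1 hv'
    exact Fin.ext (List.cons.inj hw).1.symm

theorem joints_eq {S T : PRT} {U : RelOpenSubtree T} (h : U.IsRootPiece)
    (hS : U.toTree = leafMul S) : U.joints = S.leaves.image (List.cons 1) := by
  ext v
  rw [RelOpenSubtree.mem_joints, RelOpenSubtree.IsJoint,
    ← RelOpenSubtree.isLeaf_toTree h.root_eq, hS]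
  simp only [Finset.mem_image, mem_leaves]
  constructor
  · rintro ⟨hv, hne⟩
    cases v with
    | nil => exact absurd (singleton_mem_verts_node.2 two_pos) (hv.2 0)
    | cons i v =>
      obtain ⟨hi, hv⟩ := isLeaf_node_cons.1 hv
      obtain rfl | rfl : i = 0 ∨ i = 1 := by omega
      · rw [show v = [] by simpa [verts] using hv.1] at hne
        exact absurd rfl hne
      · exact ⟨v, hv, rfl⟩
  · rintro ⟨u, hu, rfl⟩
    exact ⟨isLeaf_node_cons.2 ⟨one_lt_two, hu⟩, by simp⟩

end PRT

namespace PlanarTreeSeries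

open PRT

variable {K : Type*} [Field K]

/-! ### Coefficients of products and substitutions -/

omit [Field K] in
@[ext] theorem ext_coeff {f g : PlanarTreeSeries K} (h : ∀ T, f.coeff T = g.coeff T) : f = g :=
  funext h

theorem ord_pos_iff {g : PlanarTreeSeries K} : 0 < g.ord ↔ g.coeff none = 0 := by
  rw [← Order.one_le_iff_pos, ord, le_iInf₂_iff]
  constructor
  · intro h
    by_contra hne
    simpa [deg'] using h none hne
  · rintro h (_ | T) hT
    · exact absurd h hT
    · exact_mod_cast T.deg_pos

open Classical in
theorem coeff_graft {m : ℕ} (h : Fin m → PlanarTreeSeries K) (t : Option PRT) :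
    (graft h).coeff t =
      ∑ᶠ p : Fin m → Option PRT,
        if PRT.graft p = t then ∏ i, (h i).coeff (p i) else 0 := by
  simp only [← finsum_eq_if]
  rfl

/-- If no factor has a term in degree `0`, only graftings of nonempty trees contribute. -/
theorem prod_coeff_eq_zero_or {n : ℕ} {h : Fin (n + 2) → PlanarTreeSeries K}
    (h0 : ∀ i, (h i).coeff none = 0) (p : Fin (n + 2) → Option PRT) :
    (∏ i, (h i).coeff (p i) = 0) ∨ ∃ c : Fin (n + 2) → PRT, p = fun i => some (c i) := by
  refine or_iff_not_imp_left.2 fun hp => ?_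
  have h1 : ∀ i, ∃ T, p i = some T := by
    intro i
    refine Option.ne_none_iff_exists'.1 fun hi => hp ?_
    exact Finset.prod_eq_zero (Finset.mem_univ i) (by rw [hi, h0])
  choose c hc using h1
  exact ⟨c, funext hc⟩

open Classical in
theorem coeff_graft_node {n : ℕ} {h : Fin (n + 2) → PlanarTreeSeries K}
    (h0 : ∀ i, (h i).coeff none = 0) (c : Fin (n + 2) → PRT) :
    (graft h).coeff (some (node n c)) = ∏ i, (h i).coeff (some (c i)) := by
  rw [coeff_graft, finsum_eq_single _ fun i => some (c i), if_pos (graft_some c)]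
  · intro p hp
    refine ite_eq_right_iff.2 fun hg => ?_
    obtain h1 | ⟨d, rfl⟩ := prod_coeff_eq_zero_or h0 p
    · exact h1
    · rw [graft_some, Option.some_inj] at hg
      rw [eq_of_heq (node.inj hg).2] at hp
      exact absurd rfl hp

open Classical in
theorem coeff_graft_eq_zero {n : ℕ} {h : Fin (n + 2) → PlanarTreeSeries K}
    (h0 : ∀ i, (h i).coeff none = 0) {t : Option PRT} (ht : ∀ c, t ≠ some (node n c)) :
    (graft h).coeff t = 0 := by
  rw [coeff_graft]
  refine finsum_eq_zero_of_forall_eq_zero fun p => ite_eq_right_iff.2 fun hg => ?_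
  obtain h1 | ⟨d, rfl⟩ := prod_coeff_eq_zero_or h0 p
  · exact h1
  · rw [graft_some] at hg
    exact absurd hg.symm (ht d)

theorem coeff_evalTree_none {g : PlanarTreeSeries K} (hg : g.coeff none = 0) (S : PRT) :
    (evalTree g S).coeff none = 0 := by
  induction S with
  | leaf => exact hg
  | node n c ih => exact coeff_graft_eq_zero ih (by simp)

open Classical in
/-- A tree `T` occurs in `S(g)` only if `S` is a pruning of `T`, and then in exactly one way: each
leaf of `S` is replaced by the part of `T` above it. -/
theorem coeff_evalTree {g : PlanarTreeSeries K} (hg : g.coeff none = 0) (S T : PRT) :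
    (evalTree g S).coeff (some T) =
      if IsPruning S T then ∏ v ∈ S.leaves, g.coeff (some (T.closedSubtree v)) else 0 := by
  induction S generalizing T with
  | leaf => simp [IsPruning.leaf, leaves, evalTree]
  | node n c ih =>
    rw [evalTree]
    by_cases hT : ∃ d, T = node n d
    · obtain ⟨d, rfl⟩ := hT
      rw [coeff_graft_node fun i => coeff_evalTree_none hg (c i)]
      simp only [ih]
      split_ifs with h
      · cases h with
        | node h =>
          rw [prod_leaves_node]
          refine Finset.prod_congr rfl fun i _ => ?_
          rw [if_pos (h i)]
          simp [closedSubtree]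
      · obtain ⟨i, hi⟩ : ∃ i, ¬ IsPruning (c i) (d i) := by
          by_contra! hh
          exact h (.node hh)
        exact Finset.prod_eq_zero (Finset.mem_univ i) (if_neg hi)
    · rw [coeff_graft_eq_zero fun i => coeff_evalTree_none hg (c i), if_neg]
      · intro h
        obtain ⟨d, rfl, -⟩ := isPruning_node_iff.1 h
        exact hT ⟨d, rfl⟩
      · rintro d hd
        exact hT ⟨d, Option.some_inj.1 hd⟩

theorem coeff_subst (f g : PlanarTreeSeries K) (t : Option PRT) :
    (subst f g).coeff t = ∑ᶠ S : Option PRT, f.coeff S * (evalTree' g S).coeff t := rfl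

theorem coeff_subst_none (f : PlanarTreeSeries K) {g : PlanarTreeSeries K}
    (hg : g.coeff none = 0) : (subst f g).coeff none = f.coeff none := by
  rw [coeff_subst, finsum_eq_single _ none]
  · simp [evalTree', single, coeff]
  · rintro (_ | S) hS
    · exact absurd rfl hS
    · simp [evalTree', coeff_evalTree_none hg]

open Classical in
/-- The prunings of `T` correspond to the root pieces of `x · T`. -/
theorem coeff_subst_some (f : PlanarTreeSeries K) {g : PlanarTreeSeries K}
    (hg : g.coeff none = 0) (T : PRT) :
    (subst f g).coeff (some T) =
      ∑ U ∈ (leafMul T).rootPieces, f.coeff U.toTree.rightFactor *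
        ∏ v ∈ U.joints, g.coeff (some ((leafMul T).closedSubtree v)) := by
  have hfac : ∀ S, (leafMul S).rightFactor = some S := fun S => rfl
  have hinj : Set.InjOn (fun U => U.toTree.rightFactor)
      ((leafMul T).rootPieces : Set (RelOpenSubtree (leafMul T))) := by
    intro U hU W hW hUW
    rw [Finset.mem_coe, mem_rootPieces] at hU hW
    obtain ⟨S, hS⟩ := hU.exists_toTree_eq
    obtain ⟨S', hS'⟩ := hW.exists_toTree_eq
    simp only [hS, hS', hfac, Option.some_inj] at hUW
    exact RelOpenSubtree.eq_of_toTree_eq hU.root_eq hW.root_eq (by rw [hS, hS', hUW])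
  rw [coeff_subst, finsum_eq_finsetSum_of_support_subset
    (s := (leafMul T).rootPieces.image fun U => U.toTree.rightFactor), Finset.sum_image hinj]
  · refine Finset.sum_congr rfl fun U hU => ?_
    rw [mem_rootPieces] at hU
    obtain ⟨S, hS⟩ := hU.exists_toTree_eq
    have hp : IsPruning S T := by
      rw [← isPruning_leafMul, ← hS]
      exact RelOpenSubtree.isPruning_toTree hU.root_eq
    rw [joints_eq hU hS, Finset.prod_image fun u _ v _ h => List.cons_injective h, hS, hfac,
      evalTree', coeff_evalTree hg, if_pos hp]
    rfl
  · rintro (_ | S) hS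
    · simp [evalTree', single, coeff] at hS
    · rw [Function.mem_support, evalTree', coeff_evalTree hg] at hS
      have hp : IsPruning S T := by
        by_contra hp
        rw [if_neg hp, mul_zero] at hS
        exact hS rfl
      have hp' := isPruning_leafMul.2 hp
      simp only [Finset.coe_image, Set.mem_image, Finset.mem_coe, mem_rootPieces]
      exact ⟨hp'.toRelOpenSubtree, hp'.isRootPiece, by rw [hp'.toTree_toRelOpenSubtree, hfac]⟩

theorem coeff_X_of_ne {t : Option PRT} (h : t ≠ some leaf) :
    (X : PlanarTreeSeries K).coeff t = 0 := by
  simp [X, single, coeff, h]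

open Classical in
theorem coeff_X_mul_graft (h : PlanarTreeSeries K) {T : PRT} {t : Option PRT}
    (hT : PRT.graft ![some leaf, t] = some T) : (mul X h).coeff (some T) = h.coeff t := by
  rw [mul, coeff_graft, finsum_eq_single _ ![some leaf, t], if_pos hT]
  · simp [Fin.prod_univ_two, X, single, coeff]
  · intro p hp
    refine ite_eq_right_iff.2 fun hg => ?_
    rw [Fin.prod_univ_two]
    by_cases h0 : p 0 = some leaf
    · have hpe : p = ![some leaf, p 1] := by
        funext i
        fin_cases i
        · exact h0
        · rfl
      rw [hpe] at hg
      have := (rightFactor_eq hg).symm.trans (rightFactor_eq hT)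
      rw [this] at hpe
      exact absurd hpe hp
    · simp [coeff_X_of_ne h0]

open Classical in
theorem coeff_X_mul_eq_zero (h : PlanarTreeSeries K) {t : Option PRT}
    (ht : ∀ s, PRT.graft ![some leaf, s] ≠ t) : (mul X h).coeff t = 0 := by
  rw [mul, coeff_graft]
  refine finsum_eq_zero_of_forall_eq_zero fun p => ite_eq_right_iff.2 fun hg => ?_
  rw [Fin.prod_univ_two]
  by_cases h0 : p 0 = some leaf
  · refine absurd hg ?_
    have hpe : p = ![some leaf, p 1] := by
      funext i
      fin_cases i
      · exact h0
      · rfl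
    rw [hpe]
    exact ht _
  · simp [coeff_X_of_ne h0]

/-! ### The functional equation -/

/-- The equation `g = x · f(g)` in terms of coefficients. -/
theorem eq_X_mul_subst_iff (f : PlanarTreeSeries K) {g : PlanarTreeSeries K}
    (hg : g.coeff none = 0) :
    g = mul X (subst f g) ↔
      g.coeff (some leaf) = f.coeff none ∧
      (∀ T, g.coeff (some (leafMul T)) =
        ∑ U ∈ (leafMul T).rootPieces, f.coeff U.toTree.rightFactor *
          ∏ v ∈ U.joints, g.coeff (some ((leafMul T).closedSubtree v))) ∧
      ∀ T : PRT, ¬ T.IsRightSided → g.coeff (some T) = 0 := by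
  have h1 := coeff_X_mul_graft (subst f g) graft_leaf_none
  have h2 := fun T => coeff_X_mul_graft (subst f g) (graft_leaf_some T)
  have h3 : ∀ T : PRT, ¬ T.IsRightSided → (mul X (subst f g)).coeff (some T) = 0 :=
    fun T hT => coeff_X_mul_eq_zero _ fun s hs => hT ⟨s, hs⟩
  rw [coeff_subst_none f hg] at h1
  simp only [coeff_subst_some f hg] at h2
  constructor
  · intro h
    refine ⟨?_, fun T => ?_, fun T hT => ?_⟩
    · rw [← h1, ← h]
    · rw [← h2, ← h]
    · rw [← h3 T hT, ← h]
  · rintro ⟨e1, e2, e3⟩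
    ext t
    cases t with
    | none =>
      rw [hg, coeff_X_mul_eq_zero]
      rintro (_ | S)
      · simp [graft_leaf_none]
      · simp [graft_leaf_some]
    | some T =>
      by_cases hT : T.IsRightSided
      · obtain rfl | ⟨S, rfl⟩ := isRightSided_iff.1 hT
        · rw [e1, h1]
        · rw [e2, h2]
      · rw [e3 T hT, h3 T hT]

/-- The solution of `g = x · f(g)`: its coefficients are the sums over right-sided
decompositions, which vanish for trees that are not right-sided. -/
noncomputable def lagrangeInverse (f : PlanarTreeSeries K) : PlanarTreeSeries K
  | none => 0
  | some T => decompositionSum f T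

theorem lagrangeInverse_eq (f : PlanarTreeSeries K) :
    lagrangeInverse f = mul X (subst f (lagrangeInverse f)) :=
  (eq_X_mul_subst_iff f rfl).2 ⟨decompositionSum_leaf f,
    fun _ => decompositionSum_eq f (singleton_mem_verts_node.2 two_pos),
    fun _ hT => decompositionSum_eq_zero f hT⟩

/-- The recursion expresses each coefficient of `g` at a tree by coefficients at proper closed
subtrees, hence it has only one solution. -/
theorem eq_lagrangeInverse {f g : PlanarTreeSeries K} (hg : g.coeff none = 0)
    (h : g = mul X (subst f g)) : g = lagrangeInverse f := by
  obtain ⟨e1, e2, e3⟩ := (eq_X_mul_subst_iff f hg).1 h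
  obtain ⟨d1, d2, d3⟩ := (eq_X_mul_subst_iff f (g := lagrangeInverse f) rfl).1
    (lagrangeInverse_eq f)
  have key : ∀ (T : PRT), ∀ v ∈ T.verts, g.coeff (some (T.closedSubtree v)) =
      (lagrangeInverse f).coeff (some (T.closedSubtree v)) := by
    intro T
    induction T with
    | leaf =>
      intro v hv
      rw [show v = [] by simpa [verts] using hv, closedSubtree_nil, e1, d1]
    | node n c ih =>
      have hcons : ∀ v ∈ (node n c).verts, v ≠ [] →
          g.coeff (some ((node n c).closedSubtree v)) =
            (lagrangeInverse f).coeff (some ((node n c).closedSubtree v)) := by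
        rintro (_ | ⟨i, v⟩) hv hne
        · exact absurd rfl hne
        · obtain ⟨hi, hv⟩ := cons_mem_verts_node.1 hv
          rw [closedSubtree, dif_pos hi]
          exact ih _ v hv
      intro v hv
      by_cases hne : v = []
      · subst hne
        rw [closedSubtree_nil]
        by_cases hT : (node n c).IsRightSided
        · obtain hT | ⟨S, hT⟩ := isRightSided_iff.1 hT
          · exact absurd hT (by simp)
          · rw [hT] at hcons ⊢
            rw [e2, d2]
            refine Finset.sum_congr rfl fun U hU => ?_
            congr 1
            refine Finset.prod_congr rfl fun w hw => ?_
            rw [RelOpenSubtree.mem_joints] at hw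
            exact hcons w hw.mem_verts ((mem_rootPieces.1 hU).joint_ne_nil hw)
        · rw [e3 _ hT, d3 _ hT]
      · exact hcons v hv hne
  ext t
  cases t with
  | none => exact hg
  | some T => simpa using key T [] (nil_mem_verts T)

end PlanarTreeSeries

theorem mainTheorem1 {K : Type*} [Field K] (f : PlanarTreeSeries K) :
    (∃! g : PlanarTreeSeries K,
      0 < g.ord ∧ g = PlanarTreeSeries.mul PlanarTreeSeries.X (f.subst g)) ∧
    ∀ g : PlanarTreeSeries K,
      0 < g.ord → g = PlanarTreeSeries.mul PlanarTreeSeries.X (f.subst g) →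
      g.coeff (some PRT.leaf) = f.coeff none ∧
      ∀ T : PRT, T.IsRightSided → 1 < T.deg →
        g.coeff (some T) =
          ∑ Q ∈ T.rightSidedDecompositions, ∏ U ∈ Q, f.coeff U.toTree.rightFactor := by
  have huniq : ∀ g : PlanarTreeSeries K,
      0 < g.ord → g = PlanarTreeSeries.mul PlanarTreeSeries.X (f.subst g) →
      g = PlanarTreeSeries.lagrangeInverse f := fun g hg h =>
    PlanarTreeSeries.eq_lagrangeInverse (PlanarTreeSeries.ord_pos_iff.1 hg) h
  refine ⟨⟨PlanarTreeSeries.lagrangeInverse f,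
    ⟨PlanarTreeSeries.ord_pos_iff.2 rfl, PlanarTreeSeries.lagrangeInverse_eq f⟩,
    fun g hg => huniq g hg.1 hg.2⟩, fun g hg h => ?_⟩
  rw [huniq g hg h]
  exact ⟨PRT.decompositionSum_leaf f, fun T _ _ => rfl⟩
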